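/- For $n\in\mathbb N$ and $p\in[0,1]$ let $(X^{(n)}_t)_{t\ge 0}$ be the continuous-time Markov chain on $\{-1,1\}^n$ in which each coordinate, independently of the others, is updated at the rings of its own rate-one exponential clock, an update setting the coordinate to $1$ with probability $p$ and to $-1$ with probability $1-p$, independently of everything else. The chain starts from its stationary distribution $\pi_p$, under which the coordinates are independent and equal to $1$ with probability $p$ and to $-1$ with probability $1-p$. Write $P_p$ for the resulting probability measure. Let $(p_n)$ be a sequence in $[0,1]$. A sequence of Boolean functions $g_n\colon\{-1,1\}^n\to\{-1,1\}$ is called *volatile* with respect to $(p_n)$ if for every $\delta>0$ $$\lim_{n\to\infty}P_{p_n}\left[\tau_{\partial g_n}>\delta\right]=0,\qquad \tau_{\partial g_n}:=\inf\{t\ge 0: g_n(X^{(n)}_t)\ne g_n(X^{(n)}_0)\}\quad(\inf\emptyset=\infty),$$ and two sequences $(f_n)$, $(g_n)$ of Boolean functions are called *$o(1)$-close* with respect to $(p_n)$ if $\lim_{n\to\infty}P_{p_n}[f_n(X^{(n)}_0)\ne g_n(X^{(n)}_0)]=0$. **Theorem 1.4.** If $\lim_{n\to\infty}np_n(1-p_n)=\infty$,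 then every sequence of Boolean functions $f_n\colon\{-1,1\}^n\to\{-1,1\}$ is $o(1)$-close, with respect to $(p_n)$, to a sequence of Boolean functions that is volatile with respect to $(p_n)$. (In this sense the volatile sequences are dense in the set of all sequences of Boolean functions.) -/

import Mathlib

open MeasureTheory ProbabilityTheory Filter Topology
open scoped NNReal ENNReal

noncomputable section

namespace Volatility

/-- The hypercube `{-1, 1}^n`; the set `{-1, 1}` is the set `ℤˣ` of units of `ℤ`. -/
abbrev Cube (n : ℕ) : Type := Fin n → ℤˣ

/-- Boolean functions `{-1, 1}^n → {-1, 1}`. -/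
abbrev BoolFun (n : ℕ) : Type := Cube n → ℤˣ

/-- The randomness that drives one coordinate: the waiting times between successive rings of its
clock, and the sequence of its values (entry `0` is the initial value and entry `k + 1` is the
value set at the ring number `k + 1`). -/
abbrev CoordSpace : Type := (ℕ → ℝ) × (ℕ → ℤˣ)

/-- The waiting times are i.i.d. exponential of rate one. The values are i.i.d., equal to `1` with
probability `p` and to `-1` with probability `1 - p`, and independent of the waiting times. -/
def coordLaw (p : unitInterval) : Measure CoordSpace :=
  (Measure.infinitePi fun _ : ℕ => expMeasure 1).prod
    (Measure.infinitePi fun _ : ℕ => bernoulliMeasure (1 : ℤˣ) (-1) p)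

/-- The probability measure `P_p` of the chain on `{-1, 1}^n`: the coordinates are driven by
independent copies of the randomness of one coordinate. -/
def chainLaw (n : ℕ) (p : unitInterval) : Measure (Fin n → CoordSpace) :=
  Measure.pi fun _ : Fin n => coordLaw p

instance (p : unitInterval) : IsProbabilityMeasure (coordLaw p) := by
  have : IsProbabilityMeasure (expMeasure 1) := isProbabilityMeasure_expMeasure one_pos
  unfold coordLaw
  infer_instance

instance (n : ℕ) (p : unitInterval) : IsProbabilityMeasure (chainLaw n p) := by
  unfold chainLaw
  infer_instance

/-- The number of rings in `[0, t]` of a clock with waiting times `T 0, T 1, …`: the ring number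
`k + 1` takes place at time `T 0 + ⋯ + T k`. (Almost surely this is a finite set of rings.) -/
def ringCount (T : ℕ → ℝ) (t : ℝ≥0) : ℕ :=
  {k : ℕ | ∑ j ∈ Finset.range (k + 1), T j ≤ (t : ℝ)}.ncard

/-- The continuous-time resampling chain `X_t`: at time `t`, the coordinate `i` has the value that
was set at the last ring of its clock up to time `t`, or its initial value if there was none. -/
def chain (n : ℕ) (t : ℝ≥0) (ω : Fin n → CoordSpace) : Cube n :=
  fun i => (ω i).2 (ringCount (ω i).1 t)

/-- The hitting time `τ_{∂f}` of the set `{x | f x ≠ f X_0}` (it is `⊤` if that set is never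
hit). -/
def boundaryHittingTime {n : ℕ} (f : BoolFun n) (ω : Fin n → CoordSpace) : WithTop ℝ≥0 :=
  hittingAfter (chain n) {x | f x ≠ f (chain n 0 ω)} 0 ω

/-- The sequence `f` is volatile with respect to `p`: for all `δ > 0`,
`P_{p n}[τ_{∂(f n)} > δ] → 0`. -/
def Volatile (p : ℕ → unitInterval) (f : ∀ n, BoolFun n) : Prop :=
  ∀ δ : ℝ≥0, 0 < δ →
    Tendsto (fun n => chainLaw n (p n) {ω | (δ : WithTop ℝ≥0) < boundaryHittingTime (f n) ω})
      atTop (𝓝 0)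

/-- The sequences `f` and `g` are `o(1)`-close with respect to `p`:
`P_{p n}[f n (X_0) ≠ g n (X_0)] → 0`. -/
def OOneClose (p : ℕ → unitInterval) (f g : ∀ n, BoolFun n) : Prop :=
  Tendsto (fun n => chainLaw n (p n) {ω | f n (chain n 0 ω) ≠ g n (chain n 0 ω)}) atTop (𝓝 0)

end Volatility

end

/-! Let S be the number of coordinates equal to 1. Almost surely no two clocks ring together, so S
moves in steps of at most one and cannot skip an integer (`RegularClocks.exists_countOnes_eq`).
Redefine f as 1 where S ≡ r and as -1 where S ≡ r + 1 modulo m. Averaging over r gives a choice that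
alters f with probability at most 2/m (`exists_residue_measureReal_le`). Once S has moved by more
than m, both residues have been visited, so the modified function has changed value
(`boundaryHittingTime_modify_le`).

It remains to see that S moves by more than m within any fixed time, with probability tending to 1.
Its displacement is a sum of n i.i.d. increments, and its characteristic function is the n-th power
of 1 - 2(1 - e^{-t})p(1-p)(1 - cos θ). This tends to 0 off the multiples of 2π because np(1-p) → ∞,
and so each single value has vanishing probability (`tendsto_measure_eq_of_tendsto_character`).
Finally m → ∞ and t → 0 slowly with n. -/

noncomputable section

namespace Volatility

/-! ### Paths of the chain and the intermediate value property. -/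

/-- The time of the ring number `k + 1` of a clock with waiting times `T`. -/
def ringTime (T : ℕ → ℝ) (k : ℕ) : ℝ := ∑ j ∈ Finset.range (k + 1), T j

lemma ringCount_eq (T : ℕ → ℝ) (t : ℝ≥0) :
    ringCount T t = {k : ℕ | ringTime T k ≤ (t : ℝ)}.ncard := rfl

/-- The number of coordinates that are equal to `1`. -/
def countOnes {n : ℕ} (x : Cube n) : ℤ := ∑ i, if x i = 1 then 1 else 0

/-- All rings of all clocks occur at distinct times, and each clock rings finitely often in
bounded time. -/
structure RegularClocks {n : ℕ} (ω : Fin n → CoordSpace) : Prop where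
  injective : Function.Injective fun a : Fin n × ℕ => ringTime (ω a.1).1 a.2
  finite : ∀ (t : ℝ≥0) (i : Fin n), {k : ℕ | ringTime (ω i).1 k ≤ (t : ℝ)}.Finite

/-- The rings in the time interval `(s, t]`. -/
def ringsIn {n : ℕ} (ω : Fin n → CoordSpace) (s t : ℝ≥0) : Set (Fin n × ℕ) :=
  {a | (s : ℝ) < ringTime (ω a.1).1 a.2 ∧ ringTime (ω a.1).1 a.2 ≤ (t : ℝ)}

lemma RegularClocks.finite_ringsIn {n : ℕ} {ω : Fin n → CoordSpace} (h : RegularClocks ω)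
    (s t : ℝ≥0) : (ringsIn ω s t).Finite := by
  have : (⋃ i : Fin n, (Prod.mk i) '' {k : ℕ | ringTime (ω i).1 k ≤ (t : ℝ)}).Finite :=
    Set.finite_iUnion fun i => (h.finite t i).image _
  refine this.subset fun a ha => Set.mem_iUnion.2 ⟨a.1, a.2, ha.2, rfl⟩

lemma chain_eq_of_no_ring {n : ℕ} {ω : Fin n → CoordSpace} {s t : ℝ≥0} (hst : s ≤ t) {i : Fin n}
    (h : ∀ k, (i, k) ∉ ringsIn ω s t) : chain n s ω i = chain n t ω i := by
  have : {k : ℕ | ringTime (ω i).1 k ≤ (s : ℝ)} = {k : ℕ | ringTime (ω i).1 k ≤ (t : ℝ)} := by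
    ext k
    refine ⟨fun hk => le_trans hk (NNReal.coe_le_coe.2 hst), fun hk => ?_⟩
    by_contra hc
    exact h k ⟨not_le.1 hc, hk⟩
  simp only [chain, ringCount_eq, this]

lemma abs_countOnes_sub_le_one {n : ℕ} {x y : Cube n} (i : Fin n) (h : ∀ j ≠ i, x j = y j) :
    |countOnes x - countOnes y| ≤ 1 := by
  unfold countOnes
  rw [← Finset.sum_sub_distrib, Finset.sum_eq_single i]
  · split_ifs <;> simp
  · intro j _ hj
    simp [h j hj]
  · simp

/-- The number of ones along a path of the chain with regular clocks satisfies the intermediate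
value property. -/
lemma RegularClocks.exists_countOnes_eq {n : ℕ} {ω : Fin n → CoordSpace} (h : RegularClocks ω)
    (s t : ℝ≥0) (hst : s ≤ t) (z : ℤ)
    (hz : z ∈ Set.uIcc (countOnes (chain n s ω)) (countOnes (chain n t ω))) :
    ∃ u, u ≤ t ∧ countOnes (chain n u ω) = z := by
  induction hN : (ringsIn ω s t).ncard using Nat.strong_induction_on generalizing s t with
  | _ N ih =>
  -- With at most one ring in `(s, t]` the count moves by at most 1, so z is an endpoint value.
  -- Otherwise cut at the earlier of two rings: the half-open intervals put it in the left piece and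
  -- the later one in the right, so both pieces have fewer rings.
  by_cases hsub : (ringsIn ω s t).Subsingleton
  · have habs : |countOnes (chain n s ω) - countOnes (chain n t ω)| ≤ 1 := by
      rcases hsub.eq_empty_or_singleton with he | ⟨a, ha⟩
      · have : chain n s ω = chain n t ω := by
          ext1 i
          exact chain_eq_of_no_ring hst fun k => by simp [he]
        simp [this]
      · refine abs_countOnes_sub_le_one a.1 fun j hj => chain_eq_of_no_ring hst fun k => ?_
        rw [ha, Set.mem_singleton_iff]
        rintro rfl
        exact hj rfl
    have : countOnes (chain n s ω) = z ∨ countOnes (chain n t ω) = z := by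
      rw [Set.mem_uIcc] at hz
      rw [abs_le] at habs
      omega
    rcases this with h1 | h1
    exacts [⟨s, hst, h1⟩, ⟨t, le_rfl, h1⟩]
  · obtain ⟨a, ha, b, hb, hab⟩ : ∃ a ∈ ringsIn ω s t, ∃ b ∈ ringsIn ω s t,
        ringTime (ω a.1).1 a.2 < ringTime (ω b.1).1 b.2 := by
      rw [Set.not_subsingleton_iff] at hsub
      obtain ⟨a, ha, b, hb, hab⟩ := hsub
      rcases lt_or_gt_of_ne (h.injective.ne hab) with hlt | hlt
      exacts [⟨a, ha, b, hb, hlt⟩, ⟨b, hb, a, ha, hlt⟩]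
    set u : ℝ≥0 := ⟨ringTime (ω a.1).1 a.2, s.2.trans ha.1.le⟩ with hu
    have hsu : s ≤ u := NNReal.coe_le_coe.1 ha.1.le
    have hut : u ≤ t := NNReal.coe_le_coe.1 ha.2
    have h1 : (ringsIn ω s u).ncard < N := by
      rw [← hN]
      refine Set.ncard_lt_ncard ⟨fun c hc => ⟨hc.1, hc.2.trans (NNReal.coe_le_coe.2 hut)⟩,
        fun hc => ?_⟩ (h.finite_ringsIn s t)
      exact absurd (hc hb).2 (not_le.2 hab)
    have h2 : (ringsIn ω u t).ncard < N := by
      rw [← hN]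
      refine Set.ncard_lt_ncard ⟨fun c hc => ⟨(NNReal.coe_le_coe.2 hsu).trans_lt hc.1, hc.2⟩,
        fun hc => ?_⟩ (h.finite_ringsIn s t)
      exact absurd (hc ha).1 (lt_irrefl _)
    rcases Set.uIcc_subset_uIcc_union_uIcc (b := countOnes (chain n u ω)) hz with hz | hz
    · obtain ⟨v, hv, hv'⟩ := ih _ h1 s u hsu hz rfl
      exact ⟨v, hv.trans hut, hv'⟩
    · exact ih _ h2 u t hut hz rfl

/-- If the values `1` and `-1` of `g` are both taken before time `δ`, then the boundary of `g` is
hit before time `δ`. -/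
lemma boundaryHittingTime_le {n : ℕ} {g : BoolFun n} {ω : Fin n → CoordSpace} {δ u v : ℝ≥0}
    (hu : u ≤ δ) (hv : v ≤ δ) (h : g (chain n u ω) ≠ g (chain n v ω)) :
    boundaryHittingTime g ω ≤ δ := by
  by_cases h0 : g (chain n u ω) = g (chain n 0 ω)
  · refine (hittingAfter_le_of_mem (i := v) zero_le ?_).trans (WithTop.coe_le_coe.2 hv)
    exact fun h1 => h (h0.trans h1.symm)
  · exact (hittingAfter_le_of_mem (i := u) zero_le h0).trans (WithTop.coe_le_coe.2 hu)

/-! ### Almost sure properties of the clocks -/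

instance : IsProbabilityMeasure (expMeasure 1) := isProbabilityMeasure_expMeasure one_pos

instance : NullSingletonClass (expMeasure 1) := by
  unfold expMeasure gammaMeasure
  infer_instance

/-- The law of the waiting times of a clock. -/
def clockLaw : Measure (ℕ → ℝ) := Measure.infinitePi fun _ : ℕ => expMeasure 1

instance : IsProbabilityMeasure clockLaw := by
  unfold clockLaw
  infer_instance

lemma expMeasure_real_Iic (t : ℝ) (ht : 0 ≤ t) :
    (expMeasure 1).real (Set.Iic t) = 1 - Real.exp (-t) := by
  rw [← cdf_eq_real, cdf_expMeasure_eq one_pos]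
  simp [ht]

lemma clockLaw_ae_pos : ∀ᵐ T ∂clockLaw, ∀ k, 0 < T k := by
  rw [ae_all_iff]
  intro k
  have h : ∀ᵐ x ∂expMeasure 1, 0 < x := by
    have h0 := expMeasure_real_Iic 0 le_rfl
    rw [neg_zero, Real.exp_zero, sub_self, measureReal_eq_zero_iff] at h0
    rw [ae_iff]
    simpa [Set.Iic] using h0
  exact (measurePreserving_eval_infinitePi (fun _ : ℕ => expMeasure 1) k).quasiMeasurePreserving.ae h

/-- The first N waiting times are all at most t with probability q^N, where q < 1. Hence some
waiting time almost surely exceeds t, and no ring from that index on occurs by time t. -/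
lemma clockLaw_ae_finite (t : ℝ) : ∀ᵐ T ∂clockLaw, {k : ℕ | ringTime T k ≤ t}.Finite := by
  wlog ht : 0 ≤ t
  · filter_upwards [this 0 le_rfl] with T hT
    exact hT.subset fun k (hk : _ ≤ t) => hk.trans (not_le.1 ht).le
  have key : clockLaw {T | ∀ k, T k ≤ t} = 0 := by
    have hlt : (expMeasure 1) (Set.Iic t) < 1 := by
      rw [← ENNReal.ofReal_one, ← ENNReal.ofReal_toReal (measure_ne_top (expMeasure 1) _)]
      refine (ENNReal.ofReal_lt_ofReal_iff one_pos).2 ?_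
      have := expMeasure_real_Iic t ht
      rw [Measure.real] at this
      rw [this]
      linarith [Real.exp_pos (-t)]
    have hle : ∀ N : ℕ, clockLaw {T | ∀ k, T k ≤ t} ≤ (expMeasure 1 (Set.Iic t)) ^ N := by
      intro N
      have := Measure.infinitePi_pi (fun _ : ℕ => expMeasure 1) (s := Finset.range N)
        (t := fun _ => Set.Iic t) (fun _ _ => measurableSet_Iic)
      rw [Finset.prod_const, Finset.card_range] at this
      rw [← this]
      exact measure_mono fun T hT k _ => hT k
    exact le_antisymm (ge_of_tendsto' (ENNReal.tendsto_pow_atTop_nhds_zero_of_lt_one hlt) hle)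
      zero_le
  have key' : ∀ᵐ T ∂clockLaw, ∃ k, t < T k := by
    rw [ae_iff]
    simpa using key
  filter_upwards [clockLaw_ae_pos, key'] with T hT ⟨k, hk⟩
  refine (Set.finite_lt_nat k).subset fun l (hl : ringTime T l ≤ t) => ?_
  by_contra hc
  have : T k ≤ ringTime T l := Finset.single_le_sum (f := T) (fun j _ => (hT j).le)
    (Finset.mem_range.2 (by simp only [Set.mem_ofPred_eq] at hc; omega))
  linarith

@[fun_prop]
lemma measurable_ringTime (k : ℕ) : Measurable fun T : ℕ → ℝ => ringTime T k := by
  unfold ringTime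
  fun_prop

/-- A random variable without atoms is almost surely different from an independent one. -/
lemma ae_ne_of_indepFun {Ω : Type*} [MeasurableSpace Ω] {μ : Measure Ω} [IsProbabilityMeasure μ]
    {X Y : Ω → ℝ} (hX : Measurable X) (hY : Measurable Y) (hXY : IndepFun X Y μ)
    (h : ∀ x, μ {ω | X ω = x} = 0) : ∀ᵐ ω ∂μ, X ω ≠ Y ω := by
  have hd : MeasurableSet {q : ℝ × ℝ | q.1 = q.2} := measurableSet_eq_fun measurable_fst
    measurable_snd
  have hmap := (indepFun_iff_map_prod_eq_prod_map_map hX.aemeasurable hY.aemeasurable).1 hXY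
  have : μ.map (fun ω => (X ω, Y ω)) {q : ℝ × ℝ | q.1 = q.2} = 0 := by
    have := Measure.isProbabilityMeasure_map hX.aemeasurable (μ := μ)
    have := Measure.isProbabilityMeasure_map hY.aemeasurable (μ := μ)
    rw [hmap, Measure.prod_apply_symm hd]
    refine (lintegral_congr fun y => ?_).trans lintegral_zero
    rw [Measure.map_apply hX (measurable_prodMk_right hd)]
    exact h y
  rw [Measure.map_apply (hX.prodMk hY) hd] at this
  rw [ae_iff]
  simpa using this

/-- The first waiting time has no atoms and is independent of the sum of the others, so it almost
surely differs from c minus that sum. -/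
lemma clockLaw_ringTime_eq (k : ℕ) (c : ℝ) : clockLaw {T | ringTime T k = c} = 0 := by
  have hind : iIndepFun (fun (j : ℕ) (T : ℕ → ℝ) => T j) clockLaw :=
    iIndepFun_infinitePi (P := fun _ : ℕ => expMeasure 1) (X := fun _ x => x)
      (fun _ => measurable_id)
  have h1 := (hind.indepFun_finsetSum_of_notMem (fun j => measurable_pi_apply j)
    (s := (Finset.range (k + 1)).erase 0) (i := 0) (by simp)).symm
  have h2 := h1.comp (φ := fun x => x) (ψ := fun x => c - x) (by fun_prop) (by fun_prop)
  have h3 := ae_ne_of_indepFun (μ := clockLaw) (by fun_prop) (by fun_prop) h2 (fun x => by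
    have := (measurePreserving_eval_infinitePi (fun _ : ℕ => expMeasure 1) 0).measure_preimage
      (measurableSet_singleton x).nullMeasurableSet
    rw [measure_singleton] at this
    exact this)
  rw [ae_iff] at h3
  refine measure_mono_null (fun T hT => ?_) h3
  simp only [Set.mem_ofPred_eq, ringTime] at hT
  rw [← Finset.add_sum_erase _ _ (Finset.mem_range.2 k.succ_pos)] at hT
  simp only [ne_eq, not_not, Set.mem_ofPred_eq, Function.comp_apply, Finset.sum_apply]
  linarith

lemma measurePreserving_clock {n : ℕ} (p : unitInterval) (i : Fin n) :
    MeasurePreserving (fun ω : Fin n → CoordSpace => (ω i).1) (chainLaw n p) clockLaw :=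
  (measurePreserving_fst (μ := clockLaw)).comp
    (measurePreserving_eval (fun _ : Fin n => coordLaw p) i)

lemma chainLaw_ae_ringTime_ne {n : ℕ} (p : unitInterval) {i j : Fin n} (hij : i ≠ j) (k l : ℕ) :
    ∀ᵐ ω ∂chainLaw n p, ringTime (ω i).1 k ≠ ringTime (ω j).1 l := by
  have hind : iIndepFun (fun (i : Fin n) (ω : Fin n → CoordSpace) => ω i) (chainLaw n p) :=
    iIndepFun_pi (X := fun _ x => x) (fun _ => aemeasurable_id)
  have h := (hind.indepFun hij).comp (φ := fun a : CoordSpace => ringTime a.1 k)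
    (ψ := fun a : CoordSpace => ringTime a.1 l) (by fun_prop) (by fun_prop)
  refine ae_ne_of_indepFun (by fun_prop) (by fun_prop) h fun x => ?_
  have hm : MeasurableSet {T : ℕ → ℝ | ringTime T k = x} :=
    measurable_ringTime k (measurableSet_singleton x)
  exact ((measurePreserving_clock p i).measure_preimage hm.nullMeasurableSet).trans
    (clockLaw_ringTime_eq k x)

lemma chainLaw_ae_regularClocks (n : ℕ) (p : unitInterval) :
    ∀ᵐ ω ∂chainLaw n p, RegularClocks ω := by
  have h1 : ∀ᵐ ω ∂chainLaw n p, ∀ (i : Fin n) (k : ℕ), 0 < (ω i).1 k := by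
    rw [ae_all_iff]
    exact fun i => (measurePreserving_clock p i).quasiMeasurePreserving.ae clockLaw_ae_pos
  -- Integer horizons keep the union of null sets countable; monotonicity in time covers real t.
  have h2 : ∀ᵐ ω ∂chainLaw n p, ∀ (i : Fin n) (N : ℕ),
      {k : ℕ | ringTime (ω i).1 k ≤ (N : ℝ)}.Finite := by
    simp_rw [ae_all_iff]
    exact fun i N => (measurePreserving_clock p i).quasiMeasurePreserving.ae (clockLaw_ae_finite N)
  have h3 : ∀ᵐ ω ∂chainLaw n p, ∀ (i j : Fin n) (_ : i ≠ j) (k l : ℕ),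
      ringTime (ω i).1 k ≠ ringTime (ω j).1 l := by
    simp_rw [ae_all_iff]
    exact fun i j hij k l => chainLaw_ae_ringTime_ne p hij k l
  filter_upwards [h1, h2, h3] with ω hω1 hω2 hω3
  refine ⟨fun a b hab => ?_, fun t i => ?_⟩
  · have h12 : a.1 = b.1 := by
      by_contra hne
      exact hω3 _ _ hne _ _ hab
    have hmono : StrictMono (ringTime (ω a.1).1) := strictMono_nat_of_lt_succ fun k => by
      rw [ringTime, ringTime, Finset.sum_range_succ _ (k + 1)]
      exact lt_add_of_pos_right _ (hω1 _ _)
    refine Prod.ext h12 (hmono.injective ?_)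
    simpa [← h12] using hab
  · obtain ⟨N, hN⟩ := exists_nat_ge (t : ℝ)
    exact (hω2 i N).subset fun k (hk : _ ≤ (t : ℝ)) => hk.trans hN

/-! ### Measurability of the chain. -/

@[fun_prop]
lemma measurable_ringCount (t : ℝ≥0) : Measurable fun T : ℕ → ℝ => ringCount T t := by
  -- The cardinality is a countable sum of indicators. The conventions agree on infinite sets:
  -- `ncard` is 0 there, and so is `toReal` of `⊤`.
  have h : (fun T : ℕ → ℝ => ringCount T t) = fun T =>
      ⌊(∑' k : ℕ, {T : ℕ → ℝ | ringTime T k ≤ (t : ℝ)}.indicator (1 : (ℕ → ℝ) → ℝ≥0∞) T).toReal⌋₊ := by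
    funext T
    have : ∑' k : ℕ, {T : ℕ → ℝ | ringTime T k ≤ (t : ℝ)}.indicator (1 : (ℕ → ℝ) → ℝ≥0∞) T
        = ({k : ℕ | ringTime T k ≤ (t : ℝ)}.encard : ℝ≥0∞) := by
      rw [← ENNReal.tsum_set_one, tsum_subtype _ fun _ => (1 : ℝ≥0∞)]
      rfl
    rw [this, ringCount_eq, Set.ncard_def]
    cases {k : ℕ | ringTime T k ≤ (t : ℝ)}.encard <;> simp
  rw [h]
  refine Nat.measurable_floor.comp (Measurable.ennreal_toReal (Measurable.tsum fun k => ?_))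
  exact measurable_one.indicator (measurableSet_le (measurable_ringTime k) measurable_const)

@[fun_prop]
lemma measurable_value (t : ℝ≥0) : Measurable fun a : CoordSpace => a.2 (ringCount a.1 t) := by
  have h : Measurable fun q : (ℕ → ℤˣ) × ℕ => q.1 q.2 :=
    measurable_from_prod_countable_left fun k => measurable_pi_apply k
  exact h.comp (f := fun a : CoordSpace => (a.2, ringCount a.1 t)) (by fun_prop)

@[fun_prop]
lemma measurable_chain (n : ℕ) (t : ℝ≥0) : Measurable (chain n t) :=
  measurable_pi_lambda _ fun i => (measurable_value t).comp (measurable_pi_apply i)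

instance : MeasurableSingletonClass ℤˣ :=
  ⟨fun x => ⟨{(x : ℤ)}, measurableSet_singleton _, by ext y; simp [Units.ext_iff]⟩⟩

/-- The indicator of the value `1`. -/
def isOne (x : ℤˣ) : ℤ := if x = 1 then 1 else 0

@[fun_prop]
lemma measurable_isOne : Measurable isOne := measurable_of_finite _

/-- The increment of the indicator of the value `1` of a coordinate up to time `t`. -/
def increment (t : ℝ≥0) (a : CoordSpace) : ℤ :=
  isOne (a.2 (ringCount a.1 t)) - isOne (a.2 (ringCount a.1 0))

@[fun_prop]
lemma measurable_increment (t : ℝ≥0) : Measurable (increment t) := by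
  unfold increment
  exact (measurable_isOne.comp (measurable_value t)).sub (measurable_isOne.comp (measurable_value 0))

lemma countOnes_sub_eq_sum {n : ℕ} (t : ℝ≥0) (ω : Fin n → CoordSpace) :
    countOnes (chain n t ω) - countOnes (chain n 0 ω) = ∑ i, increment t (ω i) := by
  simp only [countOnes, ← Finset.sum_sub_distrib]
  rfl

/-! ### Characteristic function of the displacement. -/

/-- The character `y ↦ e^{iθy}` of `ℤ`. -/
def character (θ : ℝ) (y : ℤ) : ℂ := Complex.exp (θ * y * Complex.I)

lemma character_add (θ : ℝ) (y z : ℤ) :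
    character θ (y + z) = character θ y * character θ z := by
  simp only [character, ← Complex.exp_add]
  push_cast
  ring_nf

lemma character_zero (θ : ℝ) : character θ 0 = 1 := by simp [character]

lemma norm_character (θ : ℝ) (y : ℤ) : ‖character θ y‖ = 1 := by
  have := Complex.norm_exp_ofReal_mul_I (θ * y)
  push_cast at this
  exact this

lemma character_sum {ι : Type*} (s : Finset ι) (θ : ℝ) (f : ι → ℤ) :
    character θ (∑ i ∈ s, f i) = ∏ i ∈ s, character θ (f i) := by
  simp only [character, ← Complex.exp_sum, Int.cast_sum, Finset.mul_sum, Finset.sum_mul]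

@[fun_prop]
lemma measurable_character (θ : ℝ) : Measurable (character θ) := measurable_of_countable _

lemma integrable_of_norm_eq_one {Ω : Type*} [MeasurableSpace Ω] {μ : Measure Ω}
    [IsFiniteMeasure μ] {F : Ω → ℂ} (hF : Measurable F) (h : ∀ ω, ‖F ω‖ = 1) : Integrable F μ :=
  Integrable.of_bound hF.aestronglyMeasurable 1 (Eventually.of_forall fun ω => (h ω).le)

/-- The law of the values of a coordinate. -/
def valueLaw (p : unitInterval) : Measure (ℕ → ℤˣ) :=
  Measure.infinitePi fun _ : ℕ => bernoulliMeasure (1 : ℤˣ) (-1) p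

instance (p : unitInterval) : IsProbabilityMeasure (valueLaw p) := by
  unfold valueLaw
  infer_instance

lemma integral_valueLaw_eval (p : unitInterval) (k : ℕ) (F : ℤˣ → ℂ) :
    ∫ v, F (v k) ∂valueLaw p = p * F 1 + (1 - p) * F (-1) := by
  have h := (measurePreserving_eval_infinitePi
    (fun _ : ℕ => bernoulliMeasure (1 : ℤˣ) (-1) p) k)
  have h' := integral_map (μ := valueLaw p) (φ := Function.eval k) (f := F)
    (measurable_pi_apply k).aemeasurable (measurable_of_finite F).aestronglyMeasurable
  rw [valueLaw, h.map_eq] at h'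
  rw [valueLaw]
  refine h'.symm.trans ?_
  have hi : ∀ ν : Measure ℤˣ, IsFiniteMeasure ν → Integrable F ν := fun ν _ => Integrable.of_finite
  rw [bernoulliMeasure_def, integral_add_measure (hi _ inferInstance) (hi _ inferInstance),
    integral_smul_nnreal_measure, integral_smul_nnreal_measure, integral_dirac, integral_dirac]
  simp [NNReal.smul_def]

/-- As k ≠ 0, the two values are independent with the same law, so the integral is |1 - p + p
e^{iθ}|². -/
lemma integral_valueLaw_character (p : unitInterval) (θ : ℝ) {k : ℕ} (hk : k ≠ 0) :
    ∫ v, character θ (isOne (v k) - isOne (v 0)) ∂valueLaw p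
      = ((1 - 2 * p * (1 - p) * (1 - Real.cos θ) : ℝ) : ℂ) := by
  have hind : iIndepFun (fun (j : ℕ) (v : ℕ → ℤˣ) => v j) (valueLaw p) :=
    iIndepFun_infinitePi (P := fun _ : ℕ => bernoulliMeasure (1 : ℤˣ) (-1) p) (X := fun _ x => x)
      (fun _ => measurable_id)
  have h := (hind.indepFun hk).comp (φ := fun x => character θ (isOne x))
    (ψ := fun x => character θ (-isOne x)) (measurable_of_finite _) (measurable_of_finite _)
  have h2 := h.integral_fun_mul_eq_mul_integral (Measurable.aestronglyMeasurable (by fun_prop))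
    (Measurable.aestronglyMeasurable (by fun_prop))
  simp only [Function.comp_apply] at h2
  simp only [sub_eq_add_neg (isOne _), character_add]
  rw [h2, integral_valueLaw_eval p k (fun x => character θ (isOne x)),
    integral_valueLaw_eval p 0 (fun x => character θ (-isOne x))]
  have e1 : isOne 1 = 1 := rfl
  have e2 : isOne (-1) = 0 := rfl
  have e3 : character θ 1 = Complex.cos θ + Complex.sin θ * Complex.I := by
    rw [character, ← Complex.exp_mul_I]
    simp
  have e4 : character θ (-1) = Complex.cos θ - Complex.sin θ * Complex.I := by
    have := Complex.exp_mul_I (-(θ : ℂ))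
    rw [Complex.cos_neg, Complex.sin_neg] at this
    rw [character, sub_eq_add_neg, ← neg_mul, ← this]
    simp
  rw [e1, e2, neg_zero, character_zero, e3, e4]
  push_cast
  linear_combination (p : ℂ) ^ 2 * Complex.sin_sq_add_cos_sq (θ : ℂ) -
    (p : ℂ) ^ 2 * Complex.sin θ ^ 2 * Complex.I_sq

lemma ringCount_eq_zero {T : ℕ → ℝ} (h : ∀ k, 0 < T k) {t : ℝ≥0} (ht : (t : ℝ) < T 0) :
    ringCount T t = 0 := by
  have : {k : ℕ | ringTime T k ≤ (t : ℝ)} = ∅ := by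
    refine Set.eq_empty_of_forall_notMem fun k (hk : ringTime T k ≤ t) => ?_
    have : T 0 ≤ ringTime T k := Finset.single_le_sum (f := T) (fun j _ => (h j).le)
      (Finset.mem_range.2 k.succ_pos)
    linarith
  rw [ringCount_eq, this, Set.ncard_empty]

/-- Condition on the clock: with probability e^{-t} there is no ring and the increment is 0;
otherwise the current value is independent of the initial one. -/
lemma integral_character_increment (p : unitInterval) (t : ℝ≥0) (θ : ℝ) :
    ∫ a, character θ (increment t a) ∂coordLaw p
      = ((1 - 2 * (1 - Real.exp (-t)) * p * (1 - p) * (1 - Real.cos θ) : ℝ) : ℂ) := by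
  set q : ℝ := 1 - 2 * p * (1 - p) * (1 - Real.cos θ) with hq
  have hint : Integrable (fun a => character θ (increment t a)) (coordLaw p) :=
    integrable_of_norm_eq_one (by fun_prop) fun _ => norm_character _ _
  have h1 : ∫ a, character θ (increment t a) ∂coordLaw p
      = ∫ T, ∫ v, character θ (increment t (T, v)) ∂valueLaw p ∂clockLaw :=
    integral_prod (μ := clockLaw) (ν := valueLaw p) _ hint
  have h2 : ∀ᵐ T ∂clockLaw, ∫ v, character θ (increment t (T, v)) ∂valueLaw p
      = (fun x : ℝ => (1 : ℂ) + (Set.Iic (t : ℝ)).indicator (fun _ => ((q - 1 : ℝ) : ℂ)) x) (T 0) := by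
    filter_upwards [clockLaw_ae_pos, clockLaw_ae_finite t] with T hT hfin
    have h0 : ringCount T 0 = 0 := ringCount_eq_zero hT (hT 0)
    simp only [increment, h0]
    by_cases ht : (t : ℝ) < T 0
    · rw [ringCount_eq_zero hT ht]
      simp [character_zero, ht]
    · have hne : ringCount T t ≠ 0 := by
        rw [ringCount_eq]
        -- Finiteness matters here: an infinite set of rings would also have `ncard` equal to 0.
        refine ((Set.ncard_pos hfin).2 ⟨0, ?_⟩).ne'
        simpa [ringTime] using not_lt.1 ht
      rw [integral_valueLaw_character p θ hne]
      simp [not_lt.1 ht, hq]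
      ring
  have hmp := measurePreserving_eval_infinitePi (fun _ : ℕ => expMeasure 1) 0
  rw [h1, integral_congr_ae h2]
  have h3 := integral_map (μ := clockLaw) (φ := Function.eval 0)
    (f := fun x : ℝ => (1 : ℂ) + (Set.Iic (t : ℝ)).indicator (fun _ => ((q - 1 : ℝ) : ℂ)) x)
    (measurable_pi_apply 0).aemeasurable
    (Measurable.aestronglyMeasurable (measurable_const.add (measurable_const.indicator
      measurableSet_Iic)))
  rw [clockLaw, hmp.map_eq] at h3
  refine h3.symm.trans ?_
  rw [integral_add (integrable_const _) ((integrable_const _).indicator measurableSet_Iic),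
    integral_indicator_const _ measurableSet_Iic, expMeasure_real_Iic t t.coe_nonneg]
  simp [hq]
  ring

lemma integral_character_countOnes (n : ℕ) (p : unitInterval) (t : ℝ≥0) (θ : ℝ) :
    ∫ ω, character θ (countOnes (chain n t ω) - countOnes (chain n 0 ω)) ∂chainLaw n p
      = ((1 - 2 * (1 - Real.exp (-t)) * p * (1 - p) * (1 - Real.cos θ) : ℝ) : ℂ) ^ n := by
  simp only [countOnes_sub_eq_sum, character_sum]
  rw [chainLaw, integral_fintype_prod_eq_pow (fun a => character θ (increment t a)),
    integral_character_increment, Fintype.card_fin]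

lemma tendsto_integral_character_countOnes {p : ℕ → unitInterval}
    (hp : Tendsto (fun n : ℕ => (n : ℝ) * (p n : ℝ) * (1 - (p n : ℝ))) atTop atTop)
    {t : ℝ≥0} (ht : 0 < t) {θ : ℝ} (hθ : Real.cos θ < 1) :
    Tendsto (fun n => ‖∫ ω, character θ (countOnes (chain n t ω) - countOnes (chain n 0 ω))
      ∂chainLaw n (p n)‖) atTop (𝓝 0) := by
  set c : ℝ := 2 * (1 - Real.exp (-t)) * (1 - Real.cos θ) with hc
  have he : Real.exp (-t) < 1 := Real.exp_lt_one_iff.2 (by simpa using ht)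
  have hcpos : 0 < c := by
    have := sub_pos.2 he
    have := sub_pos.2 hθ
    positivity
  -- With p(1-p) ≤ 1/4 this makes 1 - cp(1-p) nonnegative, so 1 - x ≤ e^{-x} can be raised to the
  -- n-th power.
  have hc4 : c ≤ 4 := by
    have := Real.exp_pos (-t)
    have := Real.neg_one_le_cos θ
    nlinarith
  have hlim : Tendsto (fun n : ℕ => Real.exp (-(c * ((n : ℝ) * (p n : ℝ) * (1 - (p n : ℝ))))))
      atTop (𝓝 0) :=
    Real.tendsto_exp_neg_atTop_nhds_zero.comp (hp.const_mul_atTop hcpos)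
  refine squeeze_zero (fun _ => norm_nonneg _) (fun n => ?_) hlim
  have hp0 := (p n).2.1
  have hp1 := (p n).2.2
  have hpp : (p n : ℝ) * (1 - p n) ≤ 1 / 4 := by nlinarith [sq_nonneg ((p n : ℝ) - 1 / 2)]
  have hpp0 : 0 ≤ (p n : ℝ) * (1 - p n) := mul_nonneg hp0 (by linarith)
  rw [integral_character_countOnes, norm_pow, Complex.norm_real, Real.norm_eq_abs,
    show 1 - 2 * (1 - Real.exp (-t)) * p n * (1 - p n) * (1 - Real.cos θ)
      = 1 - c * ((p n : ℝ) * (1 - p n)) by rw [hc]; ring,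
    abs_of_nonneg (by nlinarith),
    show -(c * ((n : ℝ) * (p n : ℝ) * (1 - (p n : ℝ)))) = n * (-(c * ((p n : ℝ) * (1 - p n)))) by
      ring, Real.exp_nat_mul]
  exact pow_le_pow_left₀ (by nlinarith) (Real.one_sub_le_exp_neg _) n

/-! ### Anticoncentration. -/

/-- Integer valued random variables whose characteristic functions tend to `0` outside of the
multiples of `2π` spread out. -/
lemma tendsto_measure_eq_of_tendsto_character {Ω : ℕ → Type*} [∀ n, MeasurableSpace (Ω n)]
    {μ : ∀ n, Measure (Ω n)} [∀ n, IsProbabilityMeasure (μ n)] {Y : ∀ n, Ω n → ℤ}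
    (hY : ∀ n, Measurable (Y n))
    (h : ∀ θ : ℝ, Real.cos θ < 1 →
      Tendsto (fun n => ‖∫ ω, character θ (Y n ω) ∂μ n‖) atTop (𝓝 0)) (x : ℤ) :
    Tendsto (fun n => (μ n).real {ω | Y n ω = x}) atTop (𝓝 0) := by
  -- The squared modulus of the sum of e^{ij(Y-x)/M} over j < M is M² on {Y = x} and nonnegative
  -- elsewhere. Expanding its expectation leaves values of the characteristic function at (j-k)/M;
  -- only the M diagonal terms survive in the limit, so P(Y = x) is asymptotically at most 1/M.
  have key : ∀ (M : ℕ) (n : ℕ), (M : ℝ) ^ 2 * (μ n).real {ω | Y n ω = x} ≤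
      ∑ j ∈ Finset.range M, ∑ k ∈ Finset.range M,
        ‖∫ ω, character (((j : ℝ) - k) / M) (Y n ω) ∂μ n‖ := by
    intro M n
    have hexp : ∀ y : ℤ, ((‖∑ j ∈ Finset.range M, character ((j : ℝ) / M) (y - x)‖ ^ 2 : ℝ) : ℂ)
        = ∑ j ∈ Finset.range M, ∑ k ∈ Finset.range M,
          character (((j : ℝ) - k) / M) (-x) * character (((j : ℝ) - k) / M) y := by
      intro y
      rw [Complex.ofReal_pow, ← Complex.mul_conj', map_sum, Finset.sum_mul_sum]
      refine Finset.sum_congr rfl fun j _ => Finset.sum_congr rfl fun k _ => ?_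
      simp only [character, ← Complex.exp_conj, ← Complex.exp_add]
      congr 1
      simp
      ring
    have hint : ∀ (θ : ℝ), Integrable (fun ω => character θ (Y n ω)) (μ n) := fun θ =>
      integrable_of_norm_eq_one ((measurable_character θ).comp (hY n)) fun _ => norm_character _ _
    have hle : (M : ℝ) ^ 2 * (μ n).real {ω | Y n ω = x} ≤
        ∫ ω, ‖∑ j ∈ Finset.range M, character ((j : ℝ) / M) (Y n ω - x)‖ ^ 2 ∂μ n := by
      have hm : MeasurableSet {ω | Y n ω = x} := hY n (measurableSet_singleton x)
      rw [mul_comm, ← smul_eq_mul, ← integral_indicator_const _ hm]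
      refine integral_mono_of_nonneg (Eventually.of_forall fun ω => ?_) ?_
        (Eventually.of_forall fun ω => ?_)
      · exact Set.indicator_nonneg (fun _ _ => by positivity) _
      · refine Integrable.of_bound (Measurable.aestronglyMeasurable ?_) ((M : ℝ) ^ 2)
          (Eventually.of_forall fun ω => ?_)
        · exact (measurable_of_countable
            fun y : ℤ => ‖∑ j ∈ Finset.range M, character ((j : ℝ) / M) (y - x)‖ ^ 2).comp (hY n)
        · rw [Real.norm_of_nonneg (by positivity)]
          gcongr
          exact (norm_sum_le _ _).trans (by simp [norm_character])
      · by_cases hω : Y n ω = x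
        · simp [hω, character_zero]
        · rw [Set.indicator_of_notMem (by exact hω)]
          positivity
    refine hle.trans ?_
    have heq : ((∫ ω, ‖∑ j ∈ Finset.range M, character ((j : ℝ) / M) (Y n ω - x)‖ ^ 2 ∂μ n : ℝ) : ℂ)
        = ∑ j ∈ Finset.range M, ∑ k ∈ Finset.range M,
          character (((j : ℝ) - k) / M) (-x) * ∫ ω, character (((j : ℝ) - k) / M) (Y n ω) ∂μ n := by
      rw [← integral_complex_ofReal]
      simp_rw [hexp]
      rw [integral_finsetSum _ fun j _ => integrable_finsetSum _ fun k _ => (hint _).const_mul _]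
      refine Finset.sum_congr rfl fun j _ => ?_
      rw [integral_finsetSum _ fun k _ => (hint _).const_mul _]
      exact Finset.sum_congr rfl fun k _ => integral_const_mul _ _
    refine (le_abs_self _).trans ?_
    rw [← Real.norm_eq_abs, ← Complex.norm_real, heq]
    refine (norm_sum_le _ _).trans (Finset.sum_le_sum fun j _ => (norm_sum_le _ _).trans
      (Finset.sum_le_sum fun k _ => ?_))
    rw [norm_mul, norm_character, one_mul]
  rw [Metric.tendsto_atTop]
  intro ε hε
  obtain ⟨M, hM⟩ := exists_nat_gt (2 / ε)
  have hM0 : (0 : ℝ) < M := lt_trans (by positivity) hM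
  have hlim : Tendsto (fun n => ∑ j ∈ Finset.range M, ∑ k ∈ Finset.range M,
        ‖∫ ω, character (((j : ℝ) - k) / M) (Y n ω) ∂μ n‖) atTop
      (𝓝 (∑ j ∈ Finset.range M, ∑ k ∈ Finset.range M, if k = j then 1 else 0)) := by
    refine tendsto_finsetSum _ fun j hj => tendsto_finsetSum _ fun k hk => ?_
    split_ifs with hjk
    · subst hjk
      simp [character]
    -- Off the diagonal, (j-k)/M is nonzero and of modulus below 1 < 2π, so its cosine is not 1.
    · refine h _ ?_
      have hj' : (j : ℝ) < M := by exact_mod_cast Finset.mem_range.1 hj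
      have hk' : (k : ℝ) < M := by exact_mod_cast Finset.mem_range.1 hk
      have hj0 : (0 : ℝ) ≤ j := j.cast_nonneg
      have hk0 : (0 : ℝ) ≤ k := k.cast_nonneg
      have hne : (j : ℝ) - k ≠ 0 := sub_ne_zero.2 fun e => hjk (by exact_mod_cast e.symm)
      refine lt_of_le_of_ne (Real.cos_le_one _) fun e => ?_
      have h1 : |((j : ℝ) - k) / M| < 1 := by
        rw [abs_div, abs_of_pos hM0, div_lt_one hM0, abs_lt]
        constructor <;> linarith
      rw [abs_lt] at h1
      have := (Real.cos_eq_one_iff_of_lt_of_lt (by linarith [Real.pi_gt_three])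
        (by linarith [Real.pi_gt_three])).1 e
      exact (div_ne_zero hne hM0.ne') this
  have hval : (∑ j ∈ Finset.range M, ∑ k ∈ Finset.range M, if k = j then (1 : ℝ) else 0) = M := by
    rw [Finset.sum_congr rfl fun j hj => by rw [Finset.sum_ite_eq' _ _ _, if_pos hj]]
    simp
  rw [hval] at hlim
  obtain ⟨N, hN⟩ := eventually_atTop.1 (hlim.eventually_lt_const
    (show (M : ℝ) < 2 * M by linarith))
  refine ⟨N, fun n hn => ?_⟩
  rw [Real.dist_eq, sub_zero, abs_of_nonneg measureReal_nonneg]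
  have h1 := (key M n).trans_lt (hN n hn)
  rw [div_lt_iff₀ hε] at hM
  have h2 : (M : ℝ) * (μ n).real {ω | Y n ω = x} < 2 := by
    refine lt_of_mul_lt_mul_left ?_ hM0.le
    nlinarith
  refine lt_of_mul_lt_mul_left ?_ hM0.le
  linarith

lemma tendsto_measure_abs_countOnes_le {p : ℕ → unitInterval}
    (hp : Tendsto (fun n : ℕ => (n : ℝ) * (p n : ℝ) * (1 - (p n : ℝ))) atTop atTop)
    {t : ℝ≥0} (ht : 0 < t) (m : ℕ) :
    Tendsto (fun n => chainLaw n (p n)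
      {ω | |countOnes (chain n t ω) - countOnes (chain n 0 ω)| ≤ (m : ℤ)}) atTop (𝓝 0) := by
  have hmeas : ∀ n, Measurable fun ω : Fin n → CoordSpace =>
      countOnes (chain n t ω) - countOnes (chain n 0 ω) := fun n =>
    ((measurable_of_finite countOnes).comp (measurable_chain n t)).sub
      ((measurable_of_finite countOnes).comp (measurable_chain n 0))
  have h := tendsto_measure_eq_of_tendsto_character hmeas
    (fun θ hθ => tendsto_integral_character_countOnes hp ht hθ)
  have hx : ∀ x : ℤ, Tendsto (fun n => chainLaw n (p n)
      {ω | countOnes (chain n t ω) - countOnes (chain n 0 ω) = x}) atTop (𝓝 0) := fun x => by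
    have := (ENNReal.continuous_ofReal.tendsto 0).comp (h x)
    simpa [Function.comp_def] using this
  have hsum := tendsto_finsetSum (Finset.Icc (-(m : ℤ)) m) fun x _ => hx x
  rw [Finset.sum_const_zero] at hsum
  refine tendsto_of_tendsto_of_tendsto_of_le_of_le tendsto_const_nhds hsum (fun _ => zero_le)
    fun n => ?_
  refine (measure_mono fun ω hω => ?_).trans (measure_biUnion_finset_le _ _)
  exact Set.mem_iUnion₂.2 ⟨_, Finset.mem_Icc.2 (abs_le.1 hω), rfl⟩

/-! ### The modified function. -/

/-- Two consecutive residue classes have small total probability under some shift. -/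
lemma exists_residue_measureReal_le {Ω : Type*} [MeasurableSpace Ω] (μ : Measure Ω)
    [IsProbabilityMeasure μ] {m : ℕ} [NeZero m] {R : Ω → ZMod m}
    (hR : ∀ r, MeasurableSet {ω | R ω = r}) :
    ∃ r, μ.real {ω | R ω = r} + μ.real {ω | R ω = r + 1} ≤ 2 / m := by
  have hone : ∑ r, μ.real {ω | R ω = r} = 1 := by
    rw [← measureReal_biUnion_finset (fun r _ r' _ hrr' => ?_) fun r _ => hR r]
    · have : (⋃ r ∈ Finset.univ, {ω | R ω = r}) = Set.univ := by
        ext ω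
        simp
      rw [this, probReal_univ]
    · exact Set.disjoint_left.2 fun ω (h1 : R ω = r) (h2 : R ω = r') => hrr' (h1.symm.trans h2)
  have hshift : ∑ r, μ.real {ω | R ω = r + 1} = 1 :=
    (Equiv.sum_comp (Equiv.addRight (1 : ZMod m)) fun r => μ.real {ω | R ω = r}).trans hone
  have hm : (m : ℝ) ≠ 0 := Nat.cast_ne_zero.2 (NeZero.ne m)
  -- Over the m residues the two-class probabilities sum to 2, so some r is at most the average.
  obtain ⟨r, -, hr⟩ := Finset.exists_le_of_sum_le (s := (Finset.univ : Finset (ZMod m)))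
    (f := fun r => μ.real {ω | R ω = r} + μ.real {ω | R ω = r + 1}) (g := fun _ => (2 : ℝ) / m)
    Finset.univ_nonempty (by
      rw [Finset.sum_add_distrib, hone, hshift, Finset.sum_const, Finset.card_univ, ZMod.card,
        nsmul_eq_mul, mul_div_cancel₀ _ hm]
      norm_num)
  exact ⟨r, hr⟩

/-- The modification of `f` that takes the value `1` if the number of ones is `r` modulo `m`, and
the value `-1` if it is `r + 1` modulo `m`. -/
def modify {n : ℕ} (f : BoolFun n) (m : ℕ) (r : ZMod m) : BoolFun n := fun x =>
  if (countOnes x : ZMod m) = r then 1 else if (countOnes x : ZMod m) = r + 1 then -1 else f x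

lemma boundaryHittingTime_modify_le {n : ℕ} (f : BoolFun n) {m : ℕ} (hm : 2 ≤ m) (r : ZMod m)
    {ω : Fin n → CoordSpace} (hω : RegularClocks ω) {t : ℝ≥0}
    (h : (m : ℤ) < |countOnes (chain n t ω) - countOnes (chain n 0 ω)|) :
    boundaryHittingTime (modify f m r) ω ≤ t := by
  have : NeZero m := ⟨by omega⟩
  have : Fact (1 < m) := ⟨hm⟩
  set a := countOnes (chain n 0 ω)
  set b := countOnes (chain n t ω)
  -- The least shift d ≥ 0 that takes the smaller count to residue r. As d < m and the counts differ
  -- by more than m, shifts d and d + 1 both stay between them.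
  set d : ℕ := (r - ((min a b : ℤ) : ZMod m)).val with hd
  have hdm : d < m := ZMod.val_lt _
  have hmax : (m : ℤ) < max a b - min a b := by rwa [max_sub_min_eq_abs]
  have hcast : ((min a b + d : ℤ) : ZMod m) = r := by
    rw [Int.cast_add, Int.cast_natCast, hd, ZMod.natCast_zmod_val]
    ring
  obtain ⟨u, hu, hu'⟩ := hω.exists_countOnes_eq 0 t zero_le (min a b + d)
    ⟨by change min a b ≤ _; omega, by change _ ≤ max a b; omega⟩
  obtain ⟨v, hv, hv'⟩ := hω.exists_countOnes_eq 0 t zero_le (min a b + d + 1)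
    ⟨by change min a b ≤ _; omega, by change _ ≤ max a b; omega⟩
  refine boundaryHittingTime_le hu hv ?_
  have h1 : modify f m r (chain n u ω) = 1 := by
    rw [modify, hu', if_pos hcast]
  have h2 : modify f m r (chain n v ω) = -1 := by
    have : ((min a b + d + 1 : ℤ) : ZMod m) = r + 1 := by
      rw [Int.cast_add, hcast, Int.cast_one]
    rw [modify, hv', this, if_neg (by simp), if_pos rfl]
  rw [h1, h2]
  decide

lemma eventually_exists_modification {p : ℕ → unitInterval}
    (hp : Tendsto (fun n : ℕ => (n : ℝ) * (p n : ℝ) * (1 - (p n : ℝ))) atTop atTop)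
    (f : ∀ n : ℕ, BoolFun n) {m : ℕ} (hm : 2 ≤ m) {t : ℝ≥0} (ht : 0 < t) {ε : ℝ≥0∞} (hε : 0 < ε) :
    ∀ᶠ n in atTop, ∃ g : BoolFun n,
      chainLaw n (p n) {ω | f n (chain n 0 ω) ≠ g (chain n 0 ω)} ≤ ENNReal.ofReal (2 / m) ∧
      chainLaw n (p n) {ω | (t : WithTop ℝ≥0) < boundaryHittingTime g ω} ≤ ε := by
  have : NeZero m := ⟨by omega⟩
  filter_upwards [(tendsto_measure_abs_countOnes_le hp ht m).eventually_le_const hε] with n hn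
  obtain ⟨r, hr⟩ := exists_residue_measureReal_le (chainLaw n (p n))
    (R := fun ω => (countOnes (chain n 0 ω) : ZMod m))
    (fun r => (measurable_chain n 0) (Set.toFinite {x | (countOnes x : ZMod m) = r}).measurableSet)
  refine ⟨modify (f n) m r, ?_, ?_⟩
  · rw [← ofReal_measureReal]
    refine ENNReal.ofReal_le_ofReal (le_trans ?_ hr)
    refine (measureReal_mono fun ω hω => ?_).trans (measureReal_union_le _ _)
    by_contra hc
    simp only [Set.mem_union, Set.mem_ofPred_eq, not_or] at hc
    exact hω (by rw [modify, if_neg hc.1, if_neg hc.2])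
  · refine le_trans (measure_mono_ae ?_) hn
    filter_upwards [chainLaw_ae_regularClocks n (p n)] with ω hω hlt
    by_contra hc
    exact absurd (boundaryHittingTime_modify_le (f n) hm r hω (not_le.1 hc)) (not_le.2 hlt)

/-! ### Diagonalization and conclusion. -/

/-- Diagonalization: properties which hold eventually hold along an index that tends to
infinity. -/
lemma exists_tendsto_atTop_of_forall_eventually {P : ℕ → ℕ → Prop}
    (h : ∀ m, ∀ᶠ n in atTop, P m n) :
    ∃ k : ℕ → ℕ, Tendsto k atTop atTop ∧ ∀ᶠ n in atTop, P (k n) n := by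
  classical
  choose N hN using fun m => eventually_atTop.1 (h m)
  -- The largest m ≤ n whose threshold `N m` has been passed; `N 0 ≤ n` ensures that one exists.
  refine ⟨fun n => Nat.findGreatest (fun m => N m ≤ n) n, ?_, ?_⟩
  · refine tendsto_atTop.2 fun m => ?_
    filter_upwards [eventually_ge_atTop (max m (N m))] with n hn
    exact Nat.le_findGreatest (le_of_max_le_left hn) (le_of_max_le_right hn)
  · filter_upwards [eventually_ge_atTop (N 0)] with n hn
    exact hN _ _ (Nat.findGreatest_spec (P := fun m => N m ≤ n) (Nat.zero_le n) hn)

end Volatility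

end

open Volatility in
theorem theorem1p4 (p : ℕ → unitInterval)
    (hp : Tendsto (fun n : ℕ => (n : ℝ) * (p n : ℝ) * (1 - (p n : ℝ))) atTop atTop)
    (f : ∀ n : ℕ, Volatility.BoolFun n) :
    ∃ g : ∀ n : ℕ, Volatility.BoolFun n,
      Volatility.OOneClose p f g ∧ Volatility.Volatile p g := by
  have hpos : ∀ m : ℕ, (0 : ℝ≥0) < 1 / ((m : ℝ≥0) + 1) := fun m => by positivity
  -- The modulus m + 2 is always at least 2; 1/(m+1) serves both as time horizon and as error
  -- probability.
  obtain ⟨k, hk, hkP⟩ := exists_tendsto_atTop_of_forall_eventually fun m =>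
    eventually_exists_modification hp f (m := m + 2) (by omega) (hpos m)
      (ENNReal.coe_pos.2 (hpos m))
  have hsmall : Tendsto (fun n => 1 / ((k n : ℝ≥0) + 1)) atTop (𝓝 0) :=
    (tendsto_one_div_add_atTop_nhds_zero_nat (𝕜 := ℝ≥0)).comp hk
  obtain ⟨g, hgP⟩ := Filter.skolem.1 hkP
  refine ⟨g, ?_, fun δ hδ => ?_⟩
  · have h2 : Tendsto (fun n => ENNReal.ofReal (2 / (k n + 2 : ℕ))) atTop (𝓝 0) := by
      have h1 : Tendsto (fun n => (2 : ℝ) / (k n + 2 : ℕ)) atTop (𝓝 0) :=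
        (tendsto_const_div_atTop_nhds_zero_nat 2).comp ((tendsto_add_atTop_nat 2).comp hk)
      simpa [Function.comp_def] using (ENNReal.continuous_ofReal.tendsto 0).comp h1
    exact tendsto_of_tendsto_of_tendsto_of_le_of_le' tendsto_const_nhds h2
      (Eventually.of_forall fun _ => zero_le) (hgP.mono fun n hn => hn.1)
  · have h2 := (ENNReal.continuous_coe.tendsto 0).comp hsmall
    refine tendsto_of_tendsto_of_tendsto_of_le_of_le' tendsto_const_nhds h2
      (Eventually.of_forall fun _ => zero_le) ?_
    -- Once the horizon 1/(k n + 1) is below δ, not being hit by δ implies not being hit by the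
    -- horizon.
    filter_upwards [hgP, hsmall.eventually_le_const hδ] with n hn hle
    exact (measure_mono fun ω (hω : _ < _) => (WithTop.coe_le_coe.2 hle).trans_lt hω).trans hn.2
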